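/- For a finite simple graph $G$ with $n$ vertices and $m$ edges, let $L(G)=D(G)-A(G)$ be its Laplacian matrix, where $D(G)$ is the diagonal matrix of vertex degrees and $A(G)$ is the adjacency matrix. Put $LI(G)=L(G)-\frac{2m}{n}I_n$, and let $\sigma_1(LI(G))$ denote the largest singular value of $LI(G)$. A graph is called unicyclic if it is connected and has as many edges as vertices. Let $C_n$ be the cycle on $n$ vertices, and let $G_{n,n}$ be the graph on $n$ vertices that consists of one triangle together with $n-3$ pendent edges attached to one vertex of the triangle. Let $U_n$ be a unicyclic graph with $n\ge 5$ vertices. Then $$\sigma_1(LI(C_n))\le \sigma_1(LI(U_n))\le n-2.$$ Equality holds on the left if and only if $U_n\cong C_n$, and equality holds on the right if and only if $U_n\cong G_{n,n}$. -/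

import Mathlib

namespace KyFanLI

/-- The `LI`-matrix `L(G) - (2m/n) I` of a finite simple graph `G` with `n` vertices and `m` edges,
where `L(G)` is the Laplacian matrix. -/
noncomputable def LI {V : Type*} [Fintype V] [DecidableEq V] (G : SimpleGraph V)
    [DecidableRel G.Adj] : Matrix V V ℝ :=
  G.lapMatrix ℝ - (2 * (G.edgeFinset.card : ℝ) / (Fintype.card V : ℝ)) • (1 : Matrix V V ℝ)

/-- The largest singular value `σ₁(A)` of a real square matrix `A`. (The singular values of a
linear map between Euclidean spaces are listed in decreasing order, starting from index `0`.) -/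
noncomputable def sigmaOne {V : Type*} [Fintype V] [DecidableEq V] (A : Matrix V V ℝ) : ℝ :=
  (Matrix.toEuclideanLin A).singularValues 0

/-- A unicyclic graph: a connected graph with as many edges as vertices. -/
def IsUnicyclic {V : Type*} [Fintype V] (G : SimpleGraph V) [DecidableRel G.Adj] : Prop :=
  G.Connected ∧ G.edgeFinset.card = Fintype.card V

/-- The graph `G_{m,n}` (for `n ≤ m + 1` and `m + 3 ≤ 2 n`) with `n` vertices and `m` edges:
`m - n + 1` triangles with the common edge `{0, 1}` and third vertices `2, …, m - n + 2`, and
`2 n - m - 3` pendent edges at the end vertex `0` of the common edge. Thus `0` is adjacent to all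
other vertices, and `1` is also adjacent to the third vertices of the triangles. -/
def triangleBook (m n : ℕ) : SimpleGraph (Fin n) :=
  SimpleGraph.fromRel fun a b : Fin n =>
    a.val = 0 ∨ (a.val = 1 ∧ 2 ≤ b.val ∧ b.val + n ≤ m + 2)

end KyFanLI

/-! ### The largest singular value of a symmetric matrix -/

namespace KyFanLI

open Matrix Module

variable {V : Type*} [Fintype V] [DecidableEq V]

/-! For a unicyclic graph `LI G = L - 2I`, so `sigmaOne (LI G)` is the maximum of `|λ - 2|` over
Laplacian eigenvalues `λ`. The eigenvalue `0` gives the lower bound `2`; it is attained by 2-regular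
graphs, where `LI G` is minus the adjacency matrix. Conversely, if the value is `2`, every column
has squared norm `(d - 2)² + d ≤ 4`, so `d ≤ 3`; a column with `d = 3` would be orthogonal to all
others, which a vertex at distance two prevents. The degree sum then forces 2-regularity, and
connectedness a cycle.

For the upper bound, `0 ≤ λ ≤ n`, and `λ = n` requires a disconnected complement. With only `n ≥ 5`
edges, this forces a universal vertex, hence a star plus one edge. -/

theorem norm_sq_toLp {V : Type*} [Fintype V] (x : V → ℝ) : ‖WithLp.toLp 2 x‖ ^ 2 = x ⬝ᵥ x := by
  rw [EuclideanSpace.real_norm_sq_eq]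
  simp [dotProduct, sq]

theorem sigmaOne_nonneg (A : Matrix V V ℝ) : 0 ≤ sigmaOne A :=
  LinearMap.singularValues_nonneg _ _

/-- Expand in an orthonormal eigenbasis of `T* T`, whose eigenvalues are the squared singular
values. -/
theorem norm_sq_le_singularValues_zero {E F : Type*} [NormedAddCommGroup E] [InnerProductSpace ℝ E]
    [FiniteDimensional ℝ E] [NormedAddCommGroup F] [InnerProductSpace ℝ F] [FiniteDimensional ℝ F]
    (T : E →ₗ[ℝ] F) (x : E) : ‖T x‖ ^ 2 ≤ T.singularValues 0 ^ 2 * ‖x‖ ^ 2 := by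
  have hS := T.isSymmetric_adjoint_comp_self
  set b := hS.eigenvectorBasis rfl with hb
  have h1 : ‖T x‖ ^ 2 = ∑ i, inner ℝ x (b i) * inner ℝ (b i) ((LinearMap.adjoint T ∘ₗ T) x) := by
    rw [b.sum_inner_mul_inner, LinearMap.comp_apply, LinearMap.adjoint_inner_right,
      real_inner_self_eq_norm_sq]
  have h2 : ‖x‖ ^ 2 = ∑ i, inner ℝ x (b i) * inner ℝ (b i) x := by
    rw [b.sum_inner_mul_inner, real_inner_self_eq_norm_sq]
  rw [h1, h2, Finset.mul_sum]
  refine Finset.sum_le_sum fun i _ => ?_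
  have h3 : inner ℝ (b i) ((LinearMap.adjoint T ∘ₗ T) x)
      = T.singularValues i ^ 2 * inner ℝ (b i) x := by
    rw [← hS, hb, hS.apply_eigenvectorBasis, inner_smul_left, T.sq_singularValues_fin rfl]
    simp
  have h4 : T.singularValues i ^ 2 ≤ T.singularValues 0 ^ 2 :=
    pow_le_pow_left₀ (T.singularValues_nonneg _) (T.singularValues_antitone (Nat.zero_le _)) 2
  rw [h3, real_inner_comm]
  nlinarith [mul_le_mul_of_nonneg_right h4 (mul_self_nonneg (inner ℝ (b i) x))]

theorem dotProduct_mulVec_self_le (A : Matrix V V ℝ) (x : V → ℝ) :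
    (A *ᵥ x) ⬝ᵥ (A *ᵥ x) ≤ sigmaOne A ^ 2 * (x ⬝ᵥ x) := by
  have := norm_sq_le_singularValues_zero (Matrix.toEuclideanLin A) (WithLp.toLp 2 x)
  rwa [Matrix.toLpLin_toLp, norm_sq_toLp, norm_sq_toLp] at this

theorem exists_mulVec_mulVec_eq_sigmaOne_sq [Nonempty V] {A : Matrix V V ℝ} (hA : A.IsHermitian) :
    ∃ x : V → ℝ, x ≠ 0 ∧ A *ᵥ (A *ᵥ x) = sigmaOne A ^ 2 • x := by
  have h := LinearMap.hasEigenvalue_adjoint_comp_self_sq_singularValues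
    (T := Matrix.toEuclideanLin A) (n := 0) (by simp [Fintype.card_pos])
  obtain ⟨v, hv⟩ := h.exists_hasEigenvector
  refine ⟨v.ofLp, fun h0 => hv.2 (by ext i; simp [h0]), ?_⟩
  have h1 := hv.apply_eq_smul
  rw [← Matrix.toEuclideanLin_conjTranspose_eq_adjoint, hA.eq] at h1
  exact congrArg WithLp.ofLp h1

theorem abs_le_sigmaOne_of_mulVec_eq_smul {A : Matrix V V ℝ} {x : V → ℝ} {r : ℝ} (hx : x ≠ 0)
    (h : A *ᵥ x = r • x) : |r| ≤ sigmaOne A := by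
  have h1 := dotProduct_mulVec_self_le A x
  have h2 : 0 < x ⬝ᵥ x := by simpa using dotProduct_star_self_pos_iff.2 hx
  rw [h, smul_dotProduct, dotProduct_smul, smul_smul, smul_eq_mul] at h1
  have h3 := le_of_mul_le_mul_right h1 h2
  exact abs_le_of_sq_le_sq (by nlinarith) (sigmaOne_nonneg A)

theorem exists_mulVec_eq_sigmaOne_smul [Nonempty V] {A : Matrix V V ℝ} (hA : A.IsHermitian) :
    ∃ x : V → ℝ, x ≠ 0 ∧ (A *ᵥ x = sigmaOne A • x ∨ A *ᵥ x = -sigmaOne A • x) := by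
  obtain ⟨x, hx, h⟩ := exists_mulVec_mulVec_eq_sigmaOne_sq hA
  by_cases hy : A *ᵥ x + sigmaOne A • x = 0
  · exact ⟨x, hx, .inr (by rw [neg_smul]; exact eq_neg_of_add_eq_zero_left hy)⟩
  -- Since `(A - σ)(A + σ)x = 0`, the nonzero vector `Ax + σx` is an eigenvector for `σ`.
  · refine ⟨_, hy, .inl ?_⟩
    rw [mulVec_add, mulVec_smul, h, smul_add, smul_smul, sq, add_comm]

end KyFanLI

/-! ### Lower bound and its equality case -/

namespace KyFanLI

open Matrix Module

section Spectral

variable {V : Type*} [Fintype V] [DecidableEq V] (G : SimpleGraph V) [DecidableRel G.Adj]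

theorem LI_isHermitian : (LI G).IsHermitian := by
  refine (G.isHermitian_lapMatrix ℝ).sub ?_
  rw [IsHermitian, conjTranspose_smul, conjTranspose_one, star_trivial]

variable {G}

theorem LI_eq_of_card_edgeFinset_eq [Nonempty V] (h : G.edgeFinset.card = Fintype.card V) :
    LI G = G.lapMatrix ℝ - (2 : ℝ) • (1 : Matrix V V ℝ) := by
  have : (Fintype.card V : ℝ) ≠ 0 := by exact_mod_cast Fintype.card_ne_zero
  rw [LI, h, mul_div_cancel_right₀ _ this]

theorem LI_mulVec [Nonempty V] (h : G.edgeFinset.card = Fintype.card V) (x : V → ℝ) :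
    LI G *ᵥ x = G.lapMatrix ℝ *ᵥ x - (2 : ℝ) • x := by
  rw [LI_eq_of_card_edgeFinset_eq h, sub_mulVec, smul_mulVec, one_mulVec]

theorem LI_apply [Nonempty V] (h : G.edgeFinset.card = Fintype.card V) (u v : V) :
    LI G u v = (if u = v then (G.degree v : ℝ) - 2 else 0) - if G.Adj u v then 1 else 0 := by
  rw [LI_eq_of_card_edgeFinset_eq h]
  simp only [SimpleGraph.lapMatrix, SimpleGraph.degMatrix, Matrix.sub_apply, Matrix.smul_apply,
    Matrix.diagonal_apply, Matrix.one_apply, SimpleGraph.adjMatrix_apply, smul_eq_mul]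
  by_cases huv : u = v
  · subst huv; simp
  · simp [huv]

theorem two_le_sigmaOne_LI [Nonempty V] (h : G.edgeFinset.card = Fintype.card V) :
    2 ≤ sigmaOne (LI G) := by
  have h1 : LI G *ᵥ (fun _ => 1) = (-2 : ℝ) • (fun _ : V => (1 : ℝ)) := by
    rw [LI_mulVec h, G.lapMatrix_mulVec_const_eq_zero, zero_sub, neg_smul]
  have h2 : (fun _ : V => (1 : ℝ)) ≠ 0 := fun h0 => by
    simpa using congrFun h0 (Classical.arbitrary V)
  simpa using abs_le_sigmaOne_of_mulVec_eq_smul h2 h1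

omit [DecidableEq V] in
theorem card_edgeFinset_of_isRegularOfDegree_two (h : G.IsRegularOfDegree 2) :
    G.edgeFinset.card = Fintype.card V := by
  have := G.sum_degrees_eq_twice_card_edges
  simp only [h.degree_eq, Finset.sum_const, Finset.card_univ, smul_eq_mul] at this
  omega

theorem sigmaOne_LI_of_isRegularOfDegree_two [Nonempty V] (h : G.IsRegularOfDegree 2) :
    sigmaOne (LI G) = 2 := by
  have hc := card_edgeFinset_of_isRegularOfDegree_two h
  refine le_antisymm ?_ (two_le_sigmaOne_LI hc)
  obtain ⟨x, hx, hs⟩ := exists_mulVec_eq_sigmaOne_smul (LI_isHermitian G)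
  obtain ⟨v, -, hv⟩ := Finset.exists_max_image Finset.univ (fun v => |x v|) Finset.univ_nonempty
  have hpos : 0 < |x v| := by
    obtain ⟨w, hw⟩ := Function.ne_iff.1 hx
    exact (abs_pos.2 hw).trans_le (hv w (Finset.mem_univ _))
  have h1 : |(LI G *ᵥ x) v| = sigmaOne (LI G) * |x v| := by
    rcases hs with hs | hs <;> rw [hs] <;>
      simp [abs_mul, abs_of_nonneg (sigmaOne_nonneg (LI G))]
  have h2 : |(LI G *ᵥ x) v| ≤ 2 * |x v| := by
    rw [LI_mulVec hc, Pi.sub_apply, SimpleGraph.lapMatrix_mulVec_apply, h.degree_eq, Pi.smul_apply]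
    have h3 : |∑ u ∈ G.neighborFinset v, x u| ≤ 2 * |x v| := by
      refine (Finset.abs_sum_le_sum_abs _ _).trans ?_
      refine (Finset.sum_le_card_nsmul _ _ |x v| fun u _ => hv u (Finset.mem_univ _)).trans ?_
      rw [SimpleGraph.card_neighborFinset_eq_degree, h.degree_eq, nsmul_eq_mul]
      norm_num
    rw [show ((2 : ℕ) : ℝ) * x v - ∑ u ∈ G.neighborFinset v, x u - (2 : ℝ) • x v
      = -∑ u ∈ G.neighborFinset v, x u by simp, abs_neg]
    exact h3
  exact le_of_mul_le_mul_right (h1 ▸ h2) hpos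

/-- If a column of `A` has maximal norm `σ₁(A)`, then it is orthogonal to the other columns. -/
theorem dotProduct_col_eq_zero_of_col_maximal {A : Matrix V V ℝ} {v w : V} (hvw : v ≠ w)
    (h : A.col v ⬝ᵥ A.col v = sigmaOne A ^ 2) : A.col v ⬝ᵥ A.col w = 0 := by
  set p := A.col v ⬝ᵥ A.col w
  set q := A.col w ⬝ᵥ A.col w
  have key (s t : ℝ) : s ^ 2 * sigmaOne A ^ 2 + 2 * s * t * p + t ^ 2 * q
      ≤ sigmaOne A ^ 2 * (s ^ 2 + t ^ 2) := by
    have := dotProduct_mulVec_self_le A (s • Pi.single v 1 + t • Pi.single w 1)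
    rw [mulVec_add, mulVec_smul, mulVec_smul, mulVec_single_one, mulVec_single_one] at this
    simp only [dotProduct_add, add_dotProduct, smul_dotProduct, dotProduct_smul, h, smul_eq_mul,
      dotProduct_single_one, Pi.add_apply, Pi.smul_apply, Pi.single_eq_same,
      Pi.single_eq_of_ne hvw, Pi.single_eq_of_ne hvw.symm] at this
    rw [dotProduct_comm (A.col w) (A.col v)] at this
    linear_combination this
  have h0 := key 0 1
  -- With `t = p`, `key` says `p² (2s + q - σ²) ≤ 0`; this `s` makes the factor `σ² - q + 2`,
  -- positive by `h0`.
  have h1 := key (sigmaOne A ^ 2 - q + 1) p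
  nlinarith [sq_nonneg p, mul_nonneg (sub_nonneg.2 h0) (sq_nonneg p)]

theorem LI_col_dotProduct_self [Nonempty V] (h : G.edgeFinset.card = Fintype.card V) (v : V) :
    (LI G).col v ⬝ᵥ (LI G).col v = ((G.degree v : ℝ) - 2) ^ 2 + G.degree v := by
  have h1 (u : V) : (LI G).col v u * (LI G).col v u
      = (if u = v then ((G.degree v : ℝ) - 2) ^ 2 else 0) + if G.Adj v u then 1 else 0 := by
    simp only [Matrix.col_apply, LI_apply h, G.adj_comm u v]
    by_cases huv : u = v
    · subst huv; simp [sq]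
    · by_cases ha : G.Adj v u <;> simp [huv, ha]
  simp only [dotProduct, h1, Finset.sum_add_distrib, ← SimpleGraph.degree_eq_sum_if_adj]
  simp

/-- As `v` and `w` are nonadjacent, each diagonal entry meets a zero; all other products are `0` or
`(-1)(-1)`, and the common neighbour contributes `1`. -/
theorem LI_col_dotProduct_pos [Nonempty V] (h : G.edgeFinset.card = Fintype.card V) {u v w : V}
    (hvw : v ≠ w) (hn : ¬ G.Adj v w) (hv : G.Adj u v) (hw : G.Adj u w) :
    0 < (LI G).col v ⬝ᵥ (LI G).col w := by
  refine Finset.sum_pos' (fun z _ => ?_) ⟨u, Finset.mem_univ _, ?_⟩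
  · have hn' : ¬ G.Adj w v := fun h => hn h.symm
    simp only [Matrix.col_apply, LI_apply h]
    by_cases hzv : z = v
    · subst hzv; simp [hvw, hn]
    by_cases hzw : z = w
    · subst hzw; simp [hzv, hn']
    simp only [hzv, hzw, if_false, zero_sub, neg_mul_neg]
    positivity
  · simp [Matrix.col_apply, LI_apply h, hv, hw, hv.ne, hw.ne]

theorem degree_le_two_of_sigmaOne_LI_eq_two (hG : G.Connected)
    (h : G.edgeFinset.card = Fintype.card V) (hn : 5 ≤ Fintype.card V)
    (hs : sigmaOne (LI G) = 2) (v : V) : G.degree v ≤ 2 := by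
  have := hG.nonempty
  by_contra! hd
  have h1 := dotProduct_mulVec_self_le (LI G) (Pi.single v 1)
  rw [mulVec_single_one, LI_col_dotProduct_self h, dotProduct_single_one, Pi.single_eq_same,
    hs] at h1
  have h3 : (3 : ℝ) ≤ G.degree v := by exact_mod_cast hd
  have h4 : (G.degree v : ℝ) = 3 := by nlinarith
  have h5 : G.degree v = 3 := by exact_mod_cast h4
  -- The closed neighbourhood has 4 < 5 vertices, so a walk leaving it reaches a vertex at distance
  -- two from `v`.
  set S := insert v (G.neighborFinset v) with hS
  obtain ⟨z, hz⟩ : ∃ z, z ∉ S := by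
    by_contra! hall
    have : S.card ≤ 4 := by
      refine (Finset.card_insert_le _ _).trans ?_
      rw [SimpleGraph.card_neighborFinset_eq_degree, h5]
    rw [Finset.eq_univ_iff_forall.2 hall, Finset.card_univ] at this
    omega
  obtain ⟨p⟩ := hG.preconnected v z
  obtain ⟨d, -, hd1, hd2⟩ := p.exists_boundary_dart (S : Set V) (by simp [hS]) (by simpa using hz)
  have hadj := d.adj
  generalize d.fst = u at *
  generalize d.snd = w at *
  simp only [hS, Finset.coe_insert, Set.mem_insert_iff, Finset.mem_coe,
    SimpleGraph.mem_neighborFinset, not_or] at hd1 hd2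
  rcases hd1 with rfl | hu
  · exact hd2.2 hadj
  have hpos := LI_col_dotProduct_pos h (Ne.symm hd2.1) hd2.2 hu.symm hadj
  refine hpos.ne' (dotProduct_col_eq_zero_of_col_maximal (Ne.symm hd2.1) ?_)
  rw [LI_col_dotProduct_self h, hs, h4]
  norm_num

omit [DecidableEq V] in
theorem isRegularOfDegree_two_of_degree_le_two (h : G.edgeFinset.card = Fintype.card V)
    (hd : ∀ v, G.degree v ≤ 2) : G.IsRegularOfDegree 2 := by
  have hsum := G.sum_degrees_eq_twice_card_edges
  rw [h, mul_comm, ← smul_eq_mul, ← Finset.card_univ, ← Finset.sum_const] at hsum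
  exact fun v => (Finset.sum_eq_sum_iff_of_le fun v _ => hd v).1 hsum v (Finset.mem_univ _)

/-! ### Upper bound via the complement -/

theorem lapMatrix_mulVec_apply_eq_sum (x : V → ℝ) (v : V) :
    (G.lapMatrix ℝ *ᵥ x) v = ∑ u, if G.Adj v u then x v - x u else 0 := by
  rw [SimpleGraph.lapMatrix_mulVec_apply, SimpleGraph.degree_eq_sum_if_adj, Finset.sum_mul,
    SimpleGraph.neighborFinset_eq_filter, Finset.sum_filter, ← Finset.sum_sub_distrib]
  refine Finset.sum_congr rfl fun u _ => ?_
  split_ifs <;> simp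

/-- The two Laplacians add up to that of the complete graph, `nI - J`. -/
theorem lapMatrix_compl_mulVec_add (x : V → ℝ) :
    Gᶜ.lapMatrix ℝ *ᵥ x + G.lapMatrix ℝ *ᵥ x
      = (Fintype.card V : ℝ) • x - fun _ => ∑ u, x u := by
  ext v
  simp only [Pi.add_apply, Pi.sub_apply, Pi.smul_apply, lapMatrix_mulVec_apply_eq_sum, smul_eq_mul]
  rw [← Finset.sum_add_distrib, ← nsmul_eq_mul, ← Finset.card_univ, ← Finset.sum_const,
    ← Finset.sum_sub_distrib]
  refine Finset.sum_congr rfl fun u _ => ?_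
  by_cases huv : v = u
  · subst huv; simp
  · by_cases ha : G.Adj v u <;> simp [ha, huv]

theorem nonneg_of_lapMatrix_mulVec_eq_smul {x : V → ℝ} {r : ℝ} (hx : x ≠ 0)
    (h : G.lapMatrix ℝ *ᵥ x = r • x) : 0 ≤ r := by
  have h1 := (SimpleGraph.posSemidef_lapMatrix ℝ G).dotProduct_mulVec_nonneg x
  have h2 : 0 < x ⬝ᵥ x := by simpa using dotProduct_star_self_pos_iff.2 hx
  rw [h, star_trivial, dotProduct_smul, smul_eq_mul] at h1
  exact nonneg_of_mul_nonneg_left h1 h2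

theorem sum_eq_zero_of_lapMatrix_mulVec_eq_smul {x : V → ℝ} {r : ℝ} (hr : r ≠ 0)
    (h : G.lapMatrix ℝ *ᵥ x = r • x) : ∑ v, x v = 0 := by
  have h1 : (fun _ => (1 : ℝ)) ⬝ᵥ (G.lapMatrix ℝ *ᵥ x) = 0 := by
    rw [dotProduct_mulVec, ← mulVec_transpose, (G.isSymm_lapMatrix (R := ℝ)).eq,
      G.lapMatrix_mulVec_const_eq_zero, zero_dotProduct]
  rw [h, dotProduct_smul, smul_eq_mul, mul_eq_zero, or_iff_right hr] at h1
  simpa [dotProduct] using h1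

/-- Nonzero Laplacian eigenvalues are at most the number of vertices, and strictly smaller
if the complement is connected. -/
theorem eigenvalue_lapMatrix_le_card {x : V → ℝ} {r : ℝ} (hx : x ≠ 0) (hr : 0 < r)
    (h : G.lapMatrix ℝ *ᵥ x = r • x) :
    r ≤ Fintype.card V ∧ (r = Fintype.card V → ¬ Gᶜ.Preconnected) := by
  have hsum := sum_eq_zero_of_lapMatrix_mulVec_eq_smul hr.ne' h
  have h1 : Gᶜ.lapMatrix ℝ *ᵥ x = ((Fintype.card V : ℝ) - r) • x := by
    have := lapMatrix_compl_mulVec_add (G := G) x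
    rw [h, hsum] at this
    rw [sub_smul, eq_sub_iff_add_eq, this]
    ext; simp
  refine ⟨sub_nonneg.1 (nonneg_of_lapMatrix_mulVec_eq_smul hx h1), fun heq hconn => hx ?_⟩
  -- At `r = n`, `x` is in the kernel of the complement's Laplacian; a connected complement makes it
  -- constant, and its sum is zero.
  rw [heq, sub_self, zero_smul,
    SimpleGraph.lapMatrix_mulVec_eq_zero_iff_forall_reachable] at h1
  ext v
  rw [Finset.sum_congr rfl fun w _ => h1 w v (hconn w v), Finset.sum_const, nsmul_eq_mul,
    mul_eq_zero, Finset.card_univ, ← heq] at hsum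
  exact hsum.resolve_left hr.ne'

theorem sigmaOne_LI_le (hG : IsUnicyclic G) (hn : 5 ≤ Fintype.card V) :
    sigmaOne (LI G) ≤ (Fintype.card V : ℝ) - 2 ∧
      (sigmaOne (LI G) = (Fintype.card V : ℝ) - 2 → ¬ Gᶜ.Preconnected) := by
  have := hG.1.nonempty
  have hn' : (5 : ℝ) ≤ Fintype.card V := by exact_mod_cast hn
  obtain ⟨x, hx, hs | hs⟩ := exists_mulVec_eq_sigmaOne_smul (LI_isHermitian G) <;>
    rw [LI_mulVec hG.2, sub_eq_iff_eq_add, ← add_smul] at hs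
  · obtain ⟨h1, h2⟩ := eigenvalue_lapMatrix_le_card hx
      (by linarith [sigmaOne_nonneg (LI G)]) hs
    exact ⟨by linarith, fun h => h2 (by linarith)⟩
  -- Here `λ = 2 - σ ≥ 0`, so `σ ≤ 2 < n - 2`.
  · have h1 := nonneg_of_lapMatrix_mulVec_eq_smul hx hs
    exact ⟨by linarith, fun h => by linarith⟩

theorem card_sub_two_le_sigmaOne_LI (h : G.edgeFinset.card = Fintype.card V)
    (hn : 2 ≤ Fintype.card V) {c : V} (hc : ∀ v, v ≠ c → G.Adj c v) :
    (Fintype.card V : ℝ) - 2 ≤ sigmaOne (LI G) := by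
  have : Nonempty V := ⟨c⟩
  have hn' : (2 : ℝ) ≤ Fintype.card V := by exact_mod_cast hn
  -- Sum zero, and constant off `c`, which is isolated in the complement: an eigenvector of the
  -- Laplacian of `G` for `n`.
  set x : V → ℝ := (Fintype.card V : ℝ) • Pi.single c 1 - fun _ => 1 with hx
  have hx0 : x ≠ 0 := fun h0 => by
    have := congrFun h0 c
    simp only [hx, Pi.sub_apply, Pi.smul_apply, Pi.single_eq_same, smul_eq_mul, mul_one,
      Pi.zero_apply] at this
    linarith
  have h1 : Gᶜ.lapMatrix ℝ *ᵥ x = 0 := by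
    rw [SimpleGraph.lapMatrix_mulVec_eq_zero_iff_forall_adj]
    intro i j hij
    rw [SimpleGraph.compl_adj] at hij
    have hi : i ≠ c := by rintro rfl; exact hij.2 (hc _ hij.1.symm)
    have hj : j ≠ c := by rintro rfl; exact hij.2 (hc _ hij.1).symm
    simp [hx, hi, hj]
  have hsum : ∑ v, x v = 0 := by
    simp [hx, Finset.sum_sub_distrib, ← Finset.mul_sum]
  have h2 := lapMatrix_compl_mulVec_add (G := G) x
  rw [h1, hsum, zero_add] at h2
  refine (le_abs_self _).trans (abs_le_sigmaOne_of_mulVec_eq_smul hx0 ?_)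
  rw [LI_mulVec h, h2, sub_smul]
  ext; simp

end Spectral
end KyFanLI

/-! ### Identification of the extremal graphs -/

namespace KyFanLI

section Combinatorics

variable {V : Type*} [Fintype V] {G : SimpleGraph V} [DecidableRel G.Adj]

/-- Equal orders make `f` bijective; equal degrees make it map neighbourhoods onto neighbourhoods,
so it reflects adjacency. -/
theorem nonempty_iso_of_copy_of_isRegularOfDegree {W : Type*} [Fintype W] {H : SimpleGraph W}
    [DecidableRel H.Adj] {d : ℕ} (hH : H.IsRegularOfDegree d) (hG : G.IsRegularOfDegree d)
    (hcard : Fintype.card W = Fintype.card V) {f : H →g G}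
    (hf : Function.Injective f) : Nonempty (H ≃g G) := by
  classical
  have hbij : Function.Bijective f :=
    (Fintype.bijective_iff_injective_and_card f).2 ⟨hf, hcard⟩
  refine ⟨⟨Equiv.ofBijective f hbij, fun {a b} => ⟨fun h => ?_, fun h => f.map_adj h⟩⟩⟩
  have himg : (H.neighborFinset a).image f = G.neighborFinset (f a) := by
    refine Finset.eq_of_subset_of_card_le ?_ ?_
    · intro x hx
      obtain ⟨y, hy, rfl⟩ := Finset.mem_image.1 hx
      rw [SimpleGraph.mem_neighborFinset] at hy ⊢
      exact f.map_adj hy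
    · rw [Finset.card_image_of_injective _ hf, SimpleGraph.card_neighborFinset_eq_degree,
        SimpleGraph.card_neighborFinset_eq_degree, hH.degree_eq, hG.degree_eq]
  have hmem : f b ∈ G.neighborFinset (f a) := (G.mem_neighborFinset _ _).2 h
  rw [← himg, Finset.mem_image] at hmem
  obtain ⟨y, hy, hyb⟩ := hmem
  rw [← hf hyb]
  exact (H.mem_neighborFinset _ _).1 hy

theorem cycleGraph_isRegularOfDegree_two {n : ℕ} (hn : 3 ≤ n) :
    (SimpleGraph.cycleGraph n).IsRegularOfDegree 2 := by
  obtain ⟨m, rfl⟩ := Nat.exists_eq_add_of_le' hn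
  intro v
  exact SimpleGraph.cycleGraph_degree_three_le

theorem exists_isCycle_length_eq_card (hG : G.Connected) (h : G.IsRegularOfDegree 2) :
    ∃ (v : V) (p : G.Walk v v), p.IsCycle ∧ p.length = Fintype.card V := by
  classical
  have hcyc : G.IsCycles := fun v _ => by
    rw [Set.ncard_eq_toFinset_card', ← SimpleGraph.neighborFinset,
      SimpleGraph.card_neighborFinset_eq_degree, h.degree_eq]
  obtain ⟨v⟩ := hG.nonempty
  have hne : (G.neighborSet v).Nonempty := by
    obtain ⟨w, hw⟩ := (G.degree_pos_iff_exists_adj v).1 (by simp [h.degree_eq])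
    exact ⟨w, hw⟩
  obtain ⟨p, hp, hv⟩ := hcyc.exists_cycle_toSubgraph_verts_eq_connectedComponentSupp
    (c := G.connectedComponentMk v) (v := v) rfl hne
  refine ⟨v, p, hp, ?_⟩
  have huniv : p.support.tail.toFinset = Finset.univ := by
    refine Finset.eq_univ_iff_forall.2 fun w => ?_
    have hw : w ∈ p.toSubgraph.verts := by
      rw [hv]
      exact SimpleGraph.ConnectedComponent.sound (hG.preconnected w v)
    rw [SimpleGraph.Walk.mem_verts_toSubgraph, ← SimpleGraph.Walk.cons_tail_support,
      List.mem_cons] at hw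
    rw [List.mem_toFinset]
    rcases hw with rfl | hw
    · exact SimpleGraph.Walk.end_mem_tail_support hp.not_nil
    · exact hw
  rw [← Finset.card_univ, ← huniv, List.toFinset_card_of_nodup hp.support_nodup, List.length_tail,
    SimpleGraph.Walk.length_support, Nat.add_sub_cancel]

theorem nonempty_iso_cycleGraph_iff (hG : G.Connected) {n : ℕ} (hn : 3 ≤ n)
    (hV : Fintype.card V = n) :
    Nonempty (G ≃g SimpleGraph.cycleGraph n) ↔ G.IsRegularOfDegree 2 := by
  refine ⟨fun ⟨f⟩ v => ?_, fun h => ?_⟩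
  · rw [← f.degree_eq, (cycleGraph_isRegularOfDegree_two hn).degree_eq]
  · obtain ⟨f⟩ := (SimpleGraph.cycleGraph_isContained_iff hn).2
      (hV ▸ exists_isCycle_length_eq_card hG h)
    obtain ⟨e⟩ := nonempty_iso_of_copy_of_isRegularOfDegree (cycleGraph_isRegularOfDegree_two hn) h
      (by rw [Fintype.card_fin, hV]) f.injective
    exact ⟨e.symm⟩

theorem exists_forall_adj_of_not_preconnected_compl (h : G.edgeFinset.card = Fintype.card V)
    (hn : 5 ≤ Fintype.card V) (hc : ¬ Gᶜ.Preconnected) : ∃ c, ∀ v, v ≠ c → G.Adj c v := by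
  classical
  simp only [SimpleGraph.Preconnected, not_forall] at hc
  obtain ⟨a, b, hab⟩ := hc
  set S : Finset V := {x | Gᶜ.Reachable a x} with hS
  have hadj {x y : V} (hx : x ∈ S) (hy : y ∉ S) : G.Adj x y := by
    by_contra hxy
    rw [hS, Finset.mem_filter_univ] at hx hy
    refine hy (hx.trans (SimpleGraph.Adj.reachable ?_))
    rw [SimpleGraph.compl_adj]
    exact ⟨by rintro rfl; exact hy hx, hxy⟩
  have haS : a ∈ S := by simp [hS]
  have hbS : b ∉ S := by simpa [hS] using hab
  have hsum := G.sum_degrees_eq_twice_card_edges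
  rw [h, ← Finset.sum_add_sum_compl S] at hsum
  have h1 : S.card * Sᶜ.card ≤ ∑ v ∈ S, G.degree v := by
    rw [← smul_eq_mul]
    refine Finset.card_nsmul_le_sum _ _ _ fun x hx => Finset.card_le_card fun y hy => ?_
    exact (G.mem_neighborFinset _ _).2 (hadj hx (Finset.mem_compl.1 hy))
  have h2 : Sᶜ.card * S.card ≤ ∑ v ∈ Sᶜ, G.degree v := by
    rw [← smul_eq_mul]
    refine Finset.card_nsmul_le_sum _ _ _ fun x hx => Finset.card_le_card fun y hy => ?_
    exact (G.mem_neighborFinset _ _).2 (hadj hy (Finset.mem_compl.1 hx)).symm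
  have h3 := Finset.card_add_card_compl S
  have h4 : 0 < S.card := Finset.card_pos.2 ⟨a, haS⟩
  have h5 : 0 < Sᶜ.card := Finset.card_pos.2 ⟨b, Finset.mem_compl.2 hbS⟩
  -- All edges between `S` and `Sᶜ` are present, so `|S||Sᶜ| ≤ n`; if both parts had size at least
  -- 2, the product would be at least `2n - 4 > n`.
  have h6 : S.card = 1 ∨ Sᶜ.card = 1 := by
    by_contra! hne
    have h7 : 2 ≤ S.card := by omega
    have h8 : 2 ≤ Sᶜ.card := by omega
    nlinarith
  rcases h6 with h6 | h6 <;> obtain ⟨c, hc⟩ := Finset.card_eq_one.1 h6 <;> refine ⟨c, fun v hv => ?_⟩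
  · exact hadj (by simp [hc]) (by simp [hc, hv])
  · have (x : V) : x ∈ S ↔ x ≠ c := by rw [← not_iff_not, ← Finset.mem_compl, hc]; simp
    exact (hadj ((this v).2 hv) (by simp [this])).symm

/-- A graph with as many edges as vertices and a universal vertex `c` is a star
with one additional edge. -/
theorem exists_adj_iff_of_forall_adj (h : G.edgeFinset.card = Fintype.card V) {c : V}
    (hc : ∀ v, v ≠ c → G.Adj c v) :
    ∃ p q, p ≠ c ∧ q ≠ c ∧ p ≠ q ∧
      ∀ a b, G.Adj a b ↔ a ≠ b ∧ (a = c ∨ b = c ∨ s(a, b) = s(p, q)) := by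
  classical
  have hdeg : G.degree c + 1 = Fintype.card V := by
    have : G.neighborFinset c = Finset.univ.erase c := by
      ext v
      simp only [SimpleGraph.mem_neighborFinset, Finset.mem_erase, Finset.mem_univ, and_true]
      exact ⟨fun h => h.ne', hc v⟩
    rw [← SimpleGraph.card_neighborFinset_eq_degree, this,
      Finset.card_erase_of_mem (Finset.mem_univ _), Finset.card_univ]
    have : 0 < Fintype.card V := Fintype.card_pos_iff.2 ⟨c⟩
    omega
  have hcard : (G.edgeFinset \ G.incidenceFinset c).card = 1 := by
    rw [Finset.card_sdiff_of_subset (G.incidenceFinset_subset c),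
      SimpleGraph.card_incidenceFinset_eq_degree, h]
    omega
  obtain ⟨e, he⟩ := Finset.card_eq_one.1 hcard
  induction e with | _ p q
  have hmem (a b : V) : s(a, b) = s(p, q) ↔ G.Adj a b ∧ a ≠ c ∧ b ≠ c := by
    rw [← Finset.mem_singleton, ← he, Finset.mem_sdiff, SimpleGraph.mem_edgeFinset,
      SimpleGraph.mem_edgeSet, SimpleGraph.mem_incidenceFinset, SimpleGraph.mk'_mem_incidenceSet_iff]
    tauto
  obtain ⟨hpq, hp, hq⟩ := (hmem p q).1 rfl
  refine ⟨p, q, hp, hq, hpq.ne, fun a b => ?_⟩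
  rw [hmem]
  by_cases ha : a = c
  · subst ha
    exact ⟨fun h => ⟨h.ne, .inl rfl⟩, fun h => hc b h.1.symm⟩
  by_cases hb : b = c
  · subst hb
    exact ⟨fun h => ⟨h.ne, .inr (.inl rfl)⟩, fun h => (hc a h.1).symm⟩
  simp only [ha, hb, false_or, ne_eq, not_false_eq_true, and_true]
  exact ⟨fun h => ⟨h.ne, h⟩, fun h => h.2⟩

theorem triangleBook_self_adj {n : ℕ} (a b : Fin n) :
    (triangleBook n n).Adj a b ↔ a ≠ b ∧ (a.val = 0 ∨ b.val = 0 ∨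
      (a.val = 1 ∧ b.val = 2) ∨ (a.val = 2 ∧ b.val = 1)) := by
  rw [triangleBook, SimpleGraph.fromRel_adj]
  refine and_congr_right fun _ => ?_
  omega

theorem nonempty_iso_triangleBook_iff (h : G.edgeFinset.card = Fintype.card V) {n : ℕ}
    (hn : 3 ≤ n) (hV : Fintype.card V = n) :
    Nonempty (G ≃g triangleBook n n) ↔ ∃ c, ∀ v, v ≠ c → G.Adj c v := by
  classical
  refine ⟨fun ⟨f⟩ => ⟨f.symm ⟨0, by omega⟩, fun v hv => ?_⟩, fun ⟨c, hc⟩ => ?_⟩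
  · rw [← f.map_adj_iff, RelIso.apply_symm_apply, triangleBook_self_adj]
    exact ⟨fun h0 => hv (by rw [h0, RelIso.symm_apply_apply]), .inl rfl⟩
  · obtain ⟨p, q, hp, hq, hpq, hadj⟩ := exists_adj_iff_of_forall_adj h hc
    obtain ⟨e, h0, h1, h2⟩ : ∃ e : V ≃ Fin n,
        (e c).val = 0 ∧ (e p).val = 1 ∧ (e q).val = 2 := by
      set f : V → Fin n := fun x => if x = c then ⟨0, by omega⟩ else if x = p then ⟨1, by omega⟩
        else ⟨2, by omega⟩ with hf
      have hinj : Set.InjOn f ({c, p, q} : Finset V) := by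
        intro x hx y hy hxy
        simp only [Finset.coe_insert, Finset.coe_singleton, Set.mem_insert_iff,
          Set.mem_singleton_iff] at hx hy
        rcases hx with rfl | rfl | rfl <;> rcases hy with rfl | rfl | rfl <;>
          simp_all [hpq.symm, hp.symm, hq.symm]
      obtain ⟨e, he⟩ := Finset.exists_equiv_extend_of_card_eq (t := .univ)
        (by rw [hV, Finset.card_univ, Fintype.card_fin]) (Finset.subset_univ _) hinj
      refine ⟨e.trans (Equiv.subtypeUnivEquiv Finset.mem_univ), ?_, ?_, ?_⟩ <;>
        simp [he, hf, hp, hq, hpq.symm]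
    refine ⟨⟨e, fun {a b} => ?_⟩⟩
    have hval (x y : V) (k : ℕ) (hy : (e y).val = k) : (e x).val = k ↔ x = y := by
      rw [← hy, Fin.val_inj, e.apply_eq_iff_eq]
    change (triangleBook n n).Adj (e a) (e b) ↔ G.Adj a b
    rw [triangleBook_self_adj, hadj, ne_eq, e.apply_eq_iff_eq, hval a c 0 h0, hval b c 0 h0,
      hval a p 1 h1, hval b p 1 h1, hval a q 2 h2, hval b q 2 h2, Sym2.eq_iff]

end Combinatorics

end KyFanLI

theorem theorem5p4 (n : ℕ) (hn : 5 ≤ n) {V : Type*} [Fintype V] [DecidableEq V]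
    (hV : Fintype.card V = n) (U : SimpleGraph V) [DecidableRel U.Adj]
    (hU : KyFanLI.IsUnicyclic U) :
    KyFanLI.sigmaOne (KyFanLI.LI (SimpleGraph.cycleGraph n))
        ≤ KyFanLI.sigmaOne (KyFanLI.LI U) ∧
      KyFanLI.sigmaOne (KyFanLI.LI U) ≤ (n : ℝ) - 2 ∧
      (KyFanLI.sigmaOne (KyFanLI.LI U)
          = KyFanLI.sigmaOne (KyFanLI.LI (SimpleGraph.cycleGraph n)) ↔
        Nonempty (U ≃g SimpleGraph.cycleGraph n)) ∧
      (KyFanLI.sigmaOne (KyFanLI.LI U) = (n : ℝ) - 2 ↔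
        Nonempty (U ≃g KyFanLI.triangleBook n n)) := by
  subst hV
  have := hU.1.nonempty
  have : Nonempty (Fin (Fintype.card V)) := ⟨⟨0, by omega⟩⟩
  have h3 : 3 ≤ Fintype.card V := by omega
  obtain ⟨hle, heq⟩ := KyFanLI.sigmaOne_LI_le hU hn
  rw [KyFanLI.sigmaOne_LI_of_isRegularOfDegree_two (KyFanLI.cycleGraph_isRegularOfDegree_two h3),
    KyFanLI.nonempty_iso_cycleGraph_iff hU.1 h3 rfl,
    KyFanLI.nonempty_iso_triangleBook_iff hU.2 h3 rfl]
  refine ⟨KyFanLI.two_le_sigmaOne_LI hU.2, hle, ⟨fun h => ?_, fun h => ?_⟩,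
    fun h => ?_, fun ⟨c, hc⟩ => ?_⟩
  · exact KyFanLI.isRegularOfDegree_two_of_degree_le_two hU.2
      (KyFanLI.degree_le_two_of_sigmaOne_LI_eq_two hU.1 hU.2 hn h)
  · exact KyFanLI.sigmaOne_LI_of_isRegularOfDegree_two h
  · exact KyFanLI.exists_forall_adj_of_not_preconnected_compl hU.2 hn (heq h)
  · exact hle.antisymm (KyFanLI.card_sub_two_le_sigmaOne_LI hU.2 (by omega) hc)
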